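/- Let $\mathcal U\subset\mathbb C$ be open, let $h$ be holomorphic on $\mathcal U$, and let $$\mathcal H_{\mathbb C}=\{(z,\mathfrak X)\in\mathcal U\times(\mathbb C\setminus\{0\}) : \mathfrak X^2\neq h(z)\},\qquad G_h=\frac{(h(z)-\mathfrak X^2)^2\,dz^2+d\mathfrak X^2}{\mathfrak X^2}.$$ Then $G_h$ is a holomorphic metric on the open set $\mathcal H_{\mathbb C}$, that is, a symmetric, non-degenerate complex bilinear form on tangent vectors whose components are holomorphic. Form its Christoffel symbols $\Upsilon^i_{jk}=\tfrac12 G^{il}(\partial_kG_{lj}+\partial_jG_{lk}-\partial_lG_{jk})$, its Riemann tensor $R^i{}_{jkl}=\partial_k\Upsilon^i_{jl}-\partial_l\Upsilon^i_{jk}+\Upsilon^i_{mk}\Upsilon^m_{jl}-\Upsilon^i_{ml}\Upsilon^m_{jk}$ with $R_{ijkl}=G_{im}R^m{}_{jkl}$, and its Ricci tensor $R_{ij}=R^k{}_{ikj}$, using complex partial derivatives in the coordinates $(z,\mathfrak X)$. Then: 1. At every point of $\mathcal H_{\mathbb C}$ the holomorphic sectional curvature $$\frac{R_{ijkl}u^iv^ju^kv^l}{G_h(u,u)\,G_h(v,v)-G_h(u,v)^2}$$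 equals $-1$ for all complex tangent vectors $u,v$ for which the denominator is nonzero. 2. The Ricci tensor of $G_h$ equals $-G_h$ on $\mathcal H_{\mathbb C}$. 3. $(\mathcal H_{\mathbb C},G_h)$ and the complex $2$-sphere of radius $i$, $S=\{Z\in\mathbb C^3:(Z^1)^2+(Z^2)^2+(Z^3)^2=i^2=-1\}$ with the holomorphic metric induced by $(dZ^1)^2+(dZ^2)^2+(dZ^3)^2$, are locally holomorphically isometric: for all $p\in\mathcal H_{\mathbb C}$ and $q\in S$ there is a biholomorphic map $F$ from an open neighbourhood of $p$ in $\mathcal H_{\mathbb C}$ onto an open neighbourhood of $q$ in $S$ with $F(p)=q$ that pulls the metric of $S$ back to $G_h$. -/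

import Mathlib

noncomputable section

namespace HolRiem

/-! Holomorphic Riemannian geometry in global holomorphic coordinates on a subset of `ℂⁿ`.
A metric is given by its matrix of components `g Z i j`. -/

/-- The complex partial derivative `∂f/∂Zᵏ` at `Z`. -/
def partialD {n : ℕ} (k : Fin n) (f : (Fin n → ℂ) → ℂ) (Z : Fin n → ℂ) : ℂ :=
  fderiv ℂ f Z (Pi.single k 1)

/-- `g` is a holomorphic metric on the open set `D ⊆ ℂⁿ`: its components are holomorphic on `D`,
and it is symmetric and non-degenerate at every point of `D`. -/
structure IsHolomorphicMetric {n : ℕ} (D : Set (Fin n → ℂ))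
    (g : (Fin n → ℂ) → Matrix (Fin n) (Fin n) ℂ) : Prop where
  isOpen : IsOpen D
  holomorphic : ∀ i j, DifferentiableOn ℂ (fun Z => g Z i j) D
  symm : ∀ Z ∈ D, (g Z).IsSymm
  nondegenerate : ∀ Z ∈ D, (g Z).det ≠ 0

/-- The value `g_Z(u, v)` of the complex bilinear form on two tangent vectors. -/
def form {n : ℕ} (g : (Fin n → ℂ) → Matrix (Fin n) (Fin n) ℂ) (Z u v : Fin n → ℂ) : ℂ :=
  ∑ i, ∑ j, g Z i j * u i * v j

/-- Christoffel symbols of the Levi-Civita connection,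
`Γ^i_{jk} = (1/2) g^{il} (∂_k g_{lj} + ∂_j g_{lk} - ∂_l g_{jk})`. -/
def christoffel {n : ℕ} (g : (Fin n → ℂ) → Matrix (Fin n) (Fin n) ℂ) (i j k : Fin n)
    (Z : Fin n → ℂ) : ℂ :=
  (1 / 2) * ∑ l, (g Z)⁻¹ i l *
    (partialD k (fun Y => g Y l j) Z + partialD j (fun Y => g Y l k) Z
      - partialD l (fun Y => g Y j k) Z)

/-- The Riemann tensor
`R^i_{jkl} = ∂_k Γ^i_{jl} - ∂_l Γ^i_{jk} + Γ^i_{mk} Γ^m_{jl} - Γ^i_{ml} Γ^m_{jk}`. -/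
def riemann {n : ℕ} (g : (Fin n → ℂ) → Matrix (Fin n) (Fin n) ℂ) (i j k l : Fin n)
    (Z : Fin n → ℂ) : ℂ :=
  partialD k (christoffel g i j l) Z - partialD l (christoffel g i j k) Z
    + ∑ m, (christoffel g i m k Z * christoffel g m j l Z
      - christoffel g i m l Z * christoffel g m j k Z)

/-- The Riemann tensor with all indices down, `R_{ijkl} = g_{im} R^m_{jkl}`. -/
def riemannLow {n : ℕ} (g : (Fin n → ℂ) → Matrix (Fin n) (Fin n) ℂ) (i j k l : Fin n)
    (Z : Fin n → ℂ) : ℂ :=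
  ∑ m, g Z i m * riemann g m j k l Z

/-- The Ricci tensor `R_{ij} = R^k_{ikj}`. -/
def ricci {n : ℕ} (g : (Fin n → ℂ) → Matrix (Fin n) (Fin n) ℂ) (Z : Fin n → ℂ) :
    Matrix (Fin n) (Fin n) ℂ :=
  Matrix.of fun i j => ∑ k, riemann g k i k j Z

/-- `g(u,u) g(v,v) - g(u,v)²`; it is nonzero exactly when `u, v` span a complex plane on which
the metric is non-degenerate. -/
def planeDisc {n : ℕ} (g : (Fin n → ℂ) → Matrix (Fin n) (Fin n) ℂ) (Z u v : Fin n → ℂ) : ℂ :=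
  form g Z u u * form g Z v v - form g Z u v ^ 2

/-- Holomorphic sectional curvature of the complex plane spanned by `u, v`. -/
def holSectionalCurvature {n : ℕ} (g : (Fin n → ℂ) → Matrix (Fin n) (Fin n) ℂ)
    (Z u v : Fin n → ℂ) : ℂ :=
  (∑ i, ∑ j, ∑ k, ∑ l, riemannLow g i j k l Z * u i * v j * u k * v l) / planeDisc g Z u v

/-- Every non-degenerate complex tangent plane at every point of `D` has holomorphic sectional
curvature `c`. -/
def HasConstantHolSectionalCurvature {n : ℕ} (D : Set (Fin n → ℂ))
    (g : (Fin n → ℂ) → Matrix (Fin n) (Fin n) ℂ) (c : ℂ) : Prop :=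
  ∀ Z ∈ D, ∀ u v : Fin n → ℂ, planeDisc g Z u v ≠ 0 → holSectionalCurvature g Z u v = c

/-- The complex `N`-sphere of radius `r` in `ℂ^(N+1)`. -/
def complexSphere (N : ℕ) (r : ℂ) : Set (Fin (N + 1) → ℂ) :=
  {Z | ∑ i, Z i ^ 2 = r ^ 2}

/-- `F` is a holomorphic isometry from the open set `W ⊆ ℂⁿ` with metric `g` onto the open piece
`S ∩ O` of a complex submanifold `S` of `ℂᵐ`, where `S` carries the metric induced from
`(dZ¹)² + ⋯ + (dZᵐ)²`: there is a bijection `F : W → S ∩ O`, holomorphic, whose inverse is the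
restriction to `S ∩ O` of a map holomorphic on `O`, and `F` pulls the metric back to `g`. -/
structure IsHolomorphicIsometryOnto {n m : ℕ} (g : (Fin n → ℂ) → Matrix (Fin n) (Fin n) ℂ)
    (W : Set (Fin n → ℂ)) (S O : Set (Fin m → ℂ)) (F : (Fin n → ℂ) → (Fin m → ℂ)) : Prop where
  isOpen_source : IsOpen W
  isOpen_ambient : IsOpen O
  holomorphic : DifferentiableOn ℂ F W
  mapsTo : Set.MapsTo F W (S ∩ O)
  exists_inverse : ∃ E : (Fin m → ℂ) → (Fin n → ℂ), DifferentiableOn ℂ E O ∧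
    Set.MapsTo E (S ∩ O) W ∧ Set.LeftInvOn E F W ∧ Set.RightInvOn E F (S ∩ O)
  isometry : ∀ Z ∈ W, ∀ u v : Fin n → ℂ,
    ∑ a, fderiv ℂ F Z u a * fderiv ℂ F Z v a = form g Z u v

/-- The domain `{(z, X) ∈ U × (ℂ \ {0}) : X² ≠ h(z)}`, with `z = Z 0` and `X = Z 1`. -/
def odeDomain (U : Set ℂ) (h : ℂ → ℂ) : Set (Fin 2 → ℂ) :=
  {Z | Z 0 ∈ U ∧ Z 1 ≠ 0 ∧ Z 1 ^ 2 ≠ h (Z 0)}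

/-- The metric `((h(z) - X²)² dz² + dX²) / X²`, with `z = Z 0` and `X = Z 1`. -/
def odeMetric (h : ℂ → ℂ) (Z : Fin 2 → ℂ) : Matrix (Fin 2) (Fin 2) ℂ :=
  !![(h (Z 0) - Z 1 ^ 2) ^ 2 / Z 1 ^ 2, 0; 0, 1 / Z 1 ^ 2]

end HolRiem

end

/-! Curvature is a direct computation. Differentiating the explicit Christoffel symbols gives the
curvature tensor of a space form of curvature -1 (`riemann_odeMetric`), with all derivatives of h
cancelling; the sectional and Ricci claims are then linear algebra.

The isometry is explicit: F = X P(z) + Q(z)/X, where the frame solves the linear system P' = -N, Q'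
= hN, N' = 2hP - 2Q (`exists_moving_frame`). The system preserves NNᵀ - 2(PQᵀ + QPᵀ) = 1, which
makes P and Q isotropic with P·Q = -1/2 and N a unit vector orthogonal to both
(`gram_of_resolution`). Hence F·F = 2 P·Q = -1, and dF = (h/X - X) N dz + (P - Q/X²) dX has square
G_h. Suitable initial values put F(p) at any q in the sphere, and the inverse function theorem makes
F a local biholomorphism onto an open piece of it. -/

/-! ### Linear holomorphic differential equations. -/

open Metric Set in
/-- Local existence of holomorphic solutions of a linear holomorphic differential equation. -/
theorem exists_hasDerivAt_linear {E : Type*} [NormedAddCommGroup E] [NormedSpace ℂ E]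
    [CompleteSpace E] {U : Set ℂ} {z₀ : ℂ} (hU : U ∈ nhds z₀) {A : ℂ → E →L[ℂ] E}
    (hA : DifferentiableOn ℂ A U) (y₀ : E) :
    ∃ r > 0, ball z₀ r ⊆ U ∧ ∃ y : ℂ → E, y z₀ = y₀ ∧
      ∀ z ∈ ball z₀ r, HasDerivAt y (A z (y z)) z := by
  have hcont : ContinuousAt A z₀ := (hA.differentiableAt hU).continuousAt
  set M : ℝ := ‖A z₀‖ + 1 with hM
  have hMpos : 0 < M := by positivity
  have hbound : ∀ᶠ z in nhds z₀, ‖A z‖ < M :=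
    hcont.norm.eventually (gt_mem_nhds (by simp [hM]))
  obtain ⟨s, hs, hsub⟩ := Metric.mem_nhds_iff.1 (Filter.inter_mem hU hbound)
  -- With M r ≤ 1/2, the bound on each Picard increment is half the previous one.
  set r : ℝ := min s (1 / (2 * M)) with hr
  have hrpos : 0 < r := lt_min hs (by positivity)
  have hrM : M * r ≤ 1 / 2 := by
    calc M * r ≤ M * (1 / (2 * M)) := by gcongr; exact min_le_right _ _
      _ = 1 / 2 := by field_simp
  have hball : ∀ z ∈ ball z₀ r, z ∈ U ∧ ‖A z‖ ≤ M := fun z hz =>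
    have h := hsub (ball_subset_ball (min_le_left _ _) hz)
    ⟨h.1, h.2.le⟩
  have hAr : DifferentiableOn ℂ A (ball z₀ r) := hA.mono fun z hz => (hball z hz).1
  have hstep : ∀ w : ℂ → E, DifferentiableOn ℂ w (ball z₀ r) →
      ∃ v : ℂ → E, v z₀ = 0 ∧ ∀ z ∈ ball z₀ r, HasDerivAt v (A z (w z)) z := by
    intro w hw
    obtain ⟨v, hv⟩ := (hAr.clm_apply hw).isExactOn_ball
    exact ⟨fun z => v z - v z₀, sub_self _, fun z hz => (hv z hz).sub_const _⟩
  choose! T hT₀ hT using hstep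
  -- Picard increments: `w (n + 1)` is the primitive of A · `w n` vanishing at z₀. Their sum y
  -- satisfies y' = ∑ A (w n) = A y.
  let w : ℕ → ℂ → E := fun n => Nat.rec (fun _ => y₀) (fun _ v => T v) n
  have hw_succ : ∀ n, w (n + 1) = T (w n) := fun n => rfl
  have hwdiff : ∀ n, DifferentiableOn ℂ (w n) (ball z₀ r) := by
    intro n
    induction n with
    | zero => exact differentiableOn_const _
    | succ n ih => exact fun z hz => (hT _ ih z hz).differentiableAt.differentiableWithinAt
  have hwbound : ∀ n, ∀ z ∈ ball z₀ r, ‖w n z‖ ≤ ‖y₀‖ * (1 / 2) ^ n := by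
    intro n
    induction n with
    | zero => intro z _; simp [w]
    | succ n ih =>
      intro z hz
      have h := (convex_ball z₀ r).norm_image_sub_le_of_norm_hasDerivWithin_le
        (C := M * (‖y₀‖ * (1 / 2) ^ n))
        (fun x hx => (hT _ (hwdiff n) x hx).hasDerivWithinAt)
        (fun x hx => (A x).le_of_opNorm_le_of_le (hball x hx).2 (ih x hx))
        (mem_ball_self hrpos) hz
      rw [hT₀ _ (hwdiff n), sub_zero] at h
      rw [mem_ball_iff_norm] at hz
      calc ‖w (n + 1) z‖ ≤ M * (‖y₀‖ * (1 / 2) ^ n) * ‖z - z₀‖ := h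
        _ ≤ M * (‖y₀‖ * (1 / 2) ^ n) * r := by gcongr
        _ = (M * r) * (‖y₀‖ * (1 / 2) ^ n) := by ring
        _ ≤ (1 / 2) * (‖y₀‖ * (1 / 2) ^ n) := by gcongr
        _ = ‖y₀‖ * (1 / 2) ^ (n + 1) := by ring
  have hgeom : Summable fun n : ℕ => ‖y₀‖ * (1 / 2 : ℝ) ^ n := summable_geometric_two.mul_left _
  have hsum : ∀ z ∈ ball z₀ r, Summable fun n => w n z := fun z hz =>
    .of_norm_bounded hgeom fun n => hwbound n z hz
  refine ⟨r, hrpos, fun z hz => (hball z hz).1, fun z => y₀ + ∑' n, w (n + 1) z, ?_, ?_⟩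
  · simp [hw_succ, hT₀ _ (hwdiff _)]
  · intro z hz
    have hz0 := mem_ball_self (x := z₀) hrpos
    have hd := hasDerivAt_tsum_of_isPreconnected (hgeom.mul_left M) isOpen_ball
      (convex_ball z₀ r).isPreconnected (fun n x hx => hT _ (hwdiff n) x hx)
      (fun n x hx => (A x).le_of_opNorm_le_of_le (hball x hx).2 (hwbound n x hx)) hz0
      ((summable_nat_add_iff 1).2 (hsum z₀ hz0)) hz
    rw [← (A z).map_tsum (hsum z hz), (hsum z hz).tsum_eq_zero_add] at hd
    exact hd.const_add y₀

/-! ### From a metric-preserving map into the sphere to a local isometry. -/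

open Metric Set in
/-- A map into the sphere that pulls the flat metric back to a non-degenerate metric is, near every
point, a holomorphic isometry onto an open piece of the sphere. -/
theorem HolRiem.exists_isHolomorphicIsometryOnto {n : ℕ}
    {g : (Fin n → ℂ) → Matrix (Fin n) (Fin n) ℂ} {D : Set (Fin n → ℂ)} {r : ℂ}
    {F : (Fin n → ℂ) → (Fin (n + 1) → ℂ)} {p : Fin n → ℂ} (hD : IsOpen D) (hp : p ∈ D)
    (hr : r ≠ 0) (hg : (g p).det ≠ 0) (hF : ContDiffOn ℂ 1 F D)
    (hmaps : MapsTo F D (complexSphere n r))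
    (hiso : ∀ Z ∈ D, ∀ u v : Fin n → ℂ,
      ∑ a, fderiv ℂ F Z u a * fderiv ℂ F Z v a = form g Z u v) :
    ∃ (W : Set (Fin n → ℂ)) (O : Set (Fin (n + 1) → ℂ)), p ∈ W ∧ W ⊆ D ∧
      IsHolomorphicIsometryOnto g W (complexSphere n r) O F := by
  have hFp : ContDiffAt ℂ 1 F p := hF.contDiffAt (hD.mem_nhds hp)
  have hFd : HasFDerivAt F (fderiv ℂ F p) p := (hFp.differentiableAt one_ne_zero).hasFDerivAt
  have hS : ∀ Z ∈ D, ∑ a, F Z a ^ 2 = r ^ 2 := hmaps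
  have horth : ∀ v, ∑ a, F p a * fderiv ℂ F p v a = 0 := by
    intro v
    have h1 : HasFDerivAt (fun Z => ∑ a, F Z a ^ 2)
        (∑ a, (2 * F p a) • (ContinuousLinearMap.proj a).comp (fderiv ℂ F p)) p := by
      refine HasFDerivAt.fun_sum fun a _ => ?_
      have := ((hasFDerivAt_pi'.1 hFd a).pow 2)
      simpa using this
    have h2 : HasFDerivAt (fun Z => ∑ a, F Z a ^ 2) (0 : (Fin n → ℂ) →L[ℂ] ℂ) p :=
      (hasFDerivAt_const (r ^ 2) p).congr_of_eventuallyEq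
        (Filter.eventuallyEq_of_mem (hD.mem_nhds hp) hS)
    have h3 := DFunLike.congr_fun (h1.unique h2) v
    simp only [_root_.sum_apply, _root_.smul_apply,
      ContinuousLinearMap.comp_apply, ContinuousLinearMap.proj_apply, smul_eq_mul, mul_assoc,
      ← Finset.mul_sum, _root_.zero_apply] at h3
    simpa using h3
  -- Adding a radial coordinate equalises the dimensions, so the inverse function theorem applies.
  -- The radial direction F(p) is transverse to the image of dF: it is orthogonal to it, and F·F =
  -- r² ≠ 0.
  let Φ : (Fin n → ℂ) × ℂ → (Fin (n + 1) → ℂ) := fun y => y.2 • F y.1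
  let L : (Fin n → ℂ) × ℂ →L[ℂ] (Fin (n + 1) → ℂ) :=
    (fderiv ℂ F p).comp (ContinuousLinearMap.fst ℂ _ _) +
      (ContinuousLinearMap.snd ℂ (Fin n → ℂ) ℂ).smulRight (F p)
  have hL : ∀ v c, L (v, c) = fderiv ℂ F p v + c • F p := fun _ _ => rfl
  have hΦ : ContDiffAt ℂ 1 Φ (p, 1) :=
    contDiffAt_snd.smul (ContDiffAt.comp (p, (1 : ℂ)) hFp contDiffAt_fst)
  have hΦL : HasFDerivAt Φ L (p, 1) := by
    have h1 : HasFDerivAt (fun y : (Fin n → ℂ) × ℂ => F y.1)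
        ((fderiv ℂ F p).comp (ContinuousLinearMap.fst ℂ _ _)) (p, 1) :=
      HasFDerivAt.comp (p, (1 : ℂ)) hFd hasFDerivAt_fst
    have h2 := (hasFDerivAt_snd (𝕜 := ℂ) (p := (p, (1 : ℂ)))).smul h1
    exact h2.congr_fderiv (by simp [L])
  have hLinj : Function.Injective L := by
    rw [injective_iff_map_eq_zero]
    rintro ⟨v, c⟩ hvc
    rw [hL] at hvc
    have hcomp : ∀ a, fderiv ℂ F p v a + c * F p a = 0 := fun a => congrFun hvc a
    have hc : c = 0 := by
      have h1 : c * r ^ 2 = 0 := by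
        calc c * r ^ 2 = ∑ a, F p a * fderiv ℂ F p v a + c * ∑ a, F p a ^ 2 := by
              rw [horth v, hS p hp, zero_add]
          _ = ∑ a, F p a * (fderiv ℂ F p v a + c * F p a) := by
              rw [Finset.mul_sum, ← Finset.sum_add_distrib]
              exact Finset.sum_congr rfl fun a _ => by ring
          _ = 0 := by simp [hcomp]
      simpa [hr] using h1
    subst hc
    have hv0 : fderiv ℂ F p v = 0 := by simpa using hvc
    -- A vector killed by dF lies in the kernel of the metric, which is non-degenerate at p.
    have hv : v = 0 := by
      by_contra hne
      refine hg (Matrix.exists_vecMul_eq_zero_iff.1 ⟨v, hne, ?_⟩)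
      ext j
      have h1 := hiso p hp v (Pi.single j 1)
      simp only [hv0, Pi.zero_apply, zero_mul, Finset.sum_const_zero, form] at h1
      simp [Pi.single_apply] at h1
      simp [Matrix.vecMul, dotProduct, h1, mul_comm]
    simp [hv]
  let e : ((Fin n → ℂ) × ℂ) ≃L[ℂ] (Fin (n + 1) → ℂ) :=
    (LinearEquiv.ofInjectiveOfFinrankEq (L : (Fin n → ℂ) × ℂ →ₗ[ℂ] (Fin (n + 1) → ℂ)) hLinj
      (by simp)).toContinuousLinearEquiv
  have he : (e : (Fin n → ℂ) × ℂ →L[ℂ] (Fin (n + 1) → ℂ)) = L := by ext x <;> rfl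
  have hΦe : HasFDerivAt Φ (e : (Fin n → ℂ) × ℂ →L[ℂ] (Fin (n + 1) → ℂ)) (p, 1) := he ▸ hΦL
  let H := hΦ.toOpenPartialHomeomorph Φ hΦe one_ne_zero
  have hHcoe : ∀ y, H y = Φ y := fun _ => rfl
  have hHsrc : (p, (1 : ℂ)) ∈ H.source :=
    hΦ.mem_toOpenPartialHomeomorph_source hΦe one_ne_zero
  have hHtgt : Φ (p, 1) ∈ H.target := H.map_source hHsrc
  have hsymm : ContDiffAt ℂ 1 H.symm (Φ (p, 1)) := hΦ.to_localInverse hΦe one_ne_zero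
  have hsymm_p : H.symm (Φ (p, 1)) = (p, 1) := H.left_inv hHsrc
  obtain ⟨O₁, hO₁sub, hO₁, hpO₁⟩ := _root_.eventually_nhds_iff.1 (hsymm.eventually (by simp))
  -- A point c F(Z) of the sphere has c² = 1; removing c = -1 leaves only the image of F.
  let V : Set ((Fin n → ℂ) × ℂ) := D ×ˢ {c : ℂ | c ≠ -1}
  have hV : IsOpen V := hD.prod isOpen_ne
  let O : Set (Fin (n + 1) → ℂ) := (H.target ∩ H.symm ⁻¹' V) ∩ O₁
  have hO : IsOpen O := (H.isOpen_inter_preimage_symm hV).inter hO₁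
  let W : Set (Fin n → ℂ) := {Z | (Z, (1 : ℂ)) ∈ H.source ∩ H ⁻¹' O}
  have hW : IsOpen W :=
    (H.isOpen_inter_preimage hO).preimage (Continuous.prodMk_left (1 : ℂ))
  have hΦ1 : ∀ Z, Φ (Z, 1) = F Z := fun Z => one_smul _ _
  have hWD : W ⊆ D := by
    rintro Z ⟨hZ, ⟨-, hZV⟩, -⟩
    rw [mem_preimage, H.left_inv hZ] at hZV
    exact hZV.1
  have hleft : ∀ Z ∈ W, H.symm (F Z) = (Z, 1) := fun Z hZ => by
    rw [← hΦ1]; exact H.left_inv hZ.1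
  have hright : ∀ x ∈ complexSphere n r ∩ O, ∃ Z ∈ D, H.symm x = (Z, 1) ∧ F Z = x := by
    rintro x ⟨hxS, ⟨hxt, hxV⟩, -⟩
    rcases hZc : H.symm x with ⟨Z, c⟩
    have h1 : Φ (H.symm x) = x := H.right_inv hxt
    rw [mem_preimage, hZc] at hxV
    rw [hZc] at h1
    have h2 : c ^ 2 * r ^ 2 = r ^ 2 := by
      have h3 : ∑ a, x a ^ 2 = r ^ 2 := hxS
      rw [← h1] at h3
      simpa [Φ, mul_pow, ← Finset.mul_sum, hS Z hxV.1] using h3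
    have hc : c = 1 := by
      have h3 : c ^ 2 = 1 := mul_right_cancel₀ (pow_ne_zero 2 hr) (by rw [h2, one_mul])
      exact ((sq_eq_sq_iff_eq_or_eq_neg.1 (h3.trans (one_pow 2).symm)).resolve_right hxV.2)
    subst hc
    exact ⟨Z, hxV.1, rfl, by rw [← hΦ1, h1]⟩
  refine ⟨W, O, ⟨hHsrc, ⟨hHtgt, ?_⟩, hpO₁⟩, hWD, hW, hO, ?_, ?_,
    ⟨fun x => (H.symm x).1, ?_, ?_, ?_, ?_⟩, fun Z hZ => hiso Z (hWD hZ)⟩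
  · change H.symm (Φ (p, 1)) ∈ V
    rw [hsymm_p]
    exact ⟨hp, by simp only [mem_ofPred_eq]; norm_num⟩
  · exact (hF.differentiableOn one_ne_zero).mono hWD
  · intro Z hZ
    exact ⟨hmaps (hWD hZ), hΦ1 Z ▸ hZ.2⟩
  · intro x hx
    exact (((hO₁sub x hx.2).differentiableAt one_ne_zero).fst).differentiableWithinAt
  · intro x hx
    obtain ⟨Z, hZ, hxZ, hFx⟩ := hright x hx
    change ((H.symm x).1, (1 : ℂ)) ∈ H.source ∩ H ⁻¹' O
    have h1 : ((H.symm x).1, (1 : ℂ)) = H.symm x := by rw [hxZ]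
    rw [h1]
    exact ⟨H.map_target hx.2.1.1, by rw [mem_preimage, H.right_inv hx.2.1.1]; exact hx.2⟩
  · intro Z hZ
    simp [hleft Z hZ]
  · intro x hx
    obtain ⟨Z, hZ, hxZ, hFx⟩ := hright x hx
    simp [hxZ, hFx]

/-! ### Curvature of the metric. -/

namespace HolRiem

open Filter Topology

theorem isOpen_odeDomain {U : Set ℂ} (hU : IsOpen U) {h : ℂ → ℂ} (hh : DifferentiableOn ℂ h U) :
    IsOpen (odeDomain U h) := by
  have hV : IsOpen {Z : Fin 2 → ℂ | Z 0 ∈ U} := hU.preimage (continuous_apply 0)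
  have hc : ContinuousOn (fun Z : Fin 2 → ℂ => Z 1 ^ 2 - h (Z 0)) {Z | Z 0 ∈ U} :=
    ((continuous_apply 1).pow 2).continuousOn.sub
      (hh.continuousOn.comp (continuous_apply 0).continuousOn fun _ hZ => hZ)
  have h1 := (hc.isOpen_inter_preimage hV (isOpen_ne (x := (0 : ℂ)))).inter
    (isOpen_ne.preimage (continuous_apply (1 : Fin 2)) : IsOpen {Z : Fin 2 → ℂ | Z 1 ≠ 0})
  convert h1 using 1
  ext Z
  simp [odeDomain, sub_eq_zero]
  tauto

theorem isHolomorphicMetric_odeMetric {U : Set ℂ} (hU : IsOpen U) {h : ℂ → ℂ}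
    (hh : DifferentiableOn ℂ h U) : IsHolomorphicMetric (odeDomain U h) (odeMetric h) where
  isOpen := isOpen_odeDomain hU hh
  holomorphic i j := by
    intro Z hZ
    have h0 : DifferentiableAt ℂ h (Z 0) := hh.differentiableAt (hU.mem_nhds hZ.1)
    have h1 : DifferentiableAt ℂ (fun Y : Fin 2 → ℂ => h (Y 0)) Z :=
      DifferentiableAt.comp Z h0 (differentiableAt_apply 0 Z)
    have hX : Z 1 ^ 2 ≠ 0 := pow_ne_zero 2 hZ.2.1
    apply DifferentiableAt.differentiableWithinAt
    fin_cases i <;> fin_cases j <;> simp [odeMetric] <;> fun_prop (disch := assumption)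
  symm Z _ := by
    ext i j
    fin_cases i <;> fin_cases j <;> simp [odeMetric]
  nondegenerate Z hZ := by
    have h1 : h (Z 0) - Z 1 ^ 2 ≠ 0 := sub_ne_zero.2 hZ.2.2.symm
    simp [odeMetric, Matrix.det_fin_two, h1, hZ.2.1]

/-- `f` has partial derivatives `a` and `b` at `Z`, and is holomorphic there. -/
def HasPartials (f : (Fin 2 → ℂ) → ℂ) (a b : ℂ) (Z : Fin 2 → ℂ) : Prop :=
  HasFDerivAt f (a • ContinuousLinearMap.proj (R := ℂ) (φ := fun _ : Fin 2 => ℂ) 0 +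
    b • ContinuousLinearMap.proj (R := ℂ) (φ := fun _ : Fin 2 => ℂ) 1) Z

namespace HasPartials

variable {f g : (Fin 2 → ℂ) → ℂ} {a b c d : ℂ} {Z : Fin 2 → ℂ}

theorem partialD_zero (hf : HasPartials f a b Z) : partialD 0 f Z = a := by
  simp [partialD, HasFDerivAt.fderiv hf]

theorem partialD_one (hf : HasPartials f a b Z) : partialD 1 f Z = b := by
  simp [partialD, HasFDerivAt.fderiv hf]

theorem congr (hf : HasPartials f a b Z) (ha : a = c) (hb : b = d) : HasPartials f c d Z :=
  ha ▸ hb ▸ hf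

theorem congr_of_eventuallyEq (hf : HasPartials f a b Z) (hg : g =ᶠ[𝓝 Z] f) :
    HasPartials g a b Z :=
  HasFDerivAt.congr_of_eventuallyEq hf hg

theorem const (x : ℂ) : HasPartials (fun _ => x) 0 0 Z :=
  (hasFDerivAt_const x Z).congr_fderiv (by ext; simp)

theorem coord_one : HasPartials (fun Y => Y 1) 0 1 Z :=
  (hasFDerivAt_apply (𝕜 := ℂ) (1 : Fin 2) Z).congr_fderiv (by ext; simp)

theorem comp_coord_zero {φ : ℂ → ℂ} {φ' : ℂ} (hφ : HasDerivAt φ φ' (Z 0)) :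
    HasPartials (fun Y => φ (Y 0)) φ' 0 Z :=
  (hφ.comp_hasFDerivAt Z (hasFDerivAt_apply (𝕜 := ℂ) (0 : Fin 2) Z)).congr_fderiv
    (by ext; simp)

theorem add (hf : HasPartials f a b Z) (hg : HasPartials g c d Z) :
    HasPartials (fun Y => f Y + g Y) (a + c) (b + d) Z :=
  (HasFDerivAt.fun_add hf hg).congr_fderiv (by ext; simp; ring)

theorem neg (hf : HasPartials f a b Z) : HasPartials (fun Y => -f Y) (-a) (-b) Z :=
  (HasFDerivAt.fun_neg hf).congr_fderiv (by ext; simp; ring)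

theorem sub (hf : HasPartials f a b Z) (hg : HasPartials g c d Z) :
    HasPartials (fun Y => f Y - g Y) (a - c) (b - d) Z :=
  (HasFDerivAt.fun_sub hf hg).congr_fderiv (by ext; simp; ring)

theorem mul (hf : HasPartials f a b Z) (hg : HasPartials g c d Z) :
    HasPartials (fun Y => f Y * g Y) (a * g Z + f Z * c) (b * g Z + f Z * d) Z :=
  (HasFDerivAt.fun_mul hf hg).congr_fderiv (by ext; simp; ring)

theorem sq (hf : HasPartials f a b Z) :
    HasPartials (fun Y => f Y ^ 2) (2 * f Z * a) (2 * f Z * b) Z := by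
  simp only [pow_two]
  exact (hf.mul hf).congr (by ring) (by ring)

theorem div (hf : HasPartials f a b Z) (hg : HasPartials g c d Z) (h0 : g Z ≠ 0) :
    HasPartials (fun Y => f Y / g Y) ((a * g Z - f Z * c) / g Z ^ 2)
      ((b * g Z - f Z * d) / g Z ^ 2) Z := by
  have h1 : HasPartials (fun Y => (g Y)⁻¹) (-(c / g Z ^ 2)) (-(d / g Z ^ 2)) Z :=
    ((hasDerivAt_inv h0).comp_hasFDerivAt Z hg).congr_fderiv (by ext; simp; ring)
  simp only [div_eq_mul_inv] at h1 ⊢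
  refine (hf.mul h1).congr ?_ ?_ <;> field_simp <;> ring

end HasPartials

theorem partialD_congr {n : ℕ} {k : Fin n} {f g : (Fin n → ℂ) → ℂ} {Z : Fin n → ℂ}
    (hfg : f =ᶠ[𝓝 Z] g) : partialD k f Z = partialD k g Z := by
  rw [partialD, partialD, hfg.fderiv_eq]

/-- The Christoffel symbols of `odeMetric h`. -/
noncomputable def odeChristoffel (h : ℂ → ℂ) (Z : Fin 2 → ℂ) : Fin 2 → Matrix (Fin 2) (Fin 2) ℂ :=
  ![!![deriv h (Z 0) / (h (Z 0) - Z 1 ^ 2),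
        -((h (Z 0) + Z 1 ^ 2) / (Z 1 * (h (Z 0) - Z 1 ^ 2)));
      -((h (Z 0) + Z 1 ^ 2) / (Z 1 * (h (Z 0) - Z 1 ^ 2))), 0],
    !![(h (Z 0) - Z 1 ^ 2) * (h (Z 0) + Z 1 ^ 2) / Z 1, 0; 0, -(1 / Z 1)]]

theorem christoffel_odeMetric {U : Set ℂ} (hU : IsOpen U) {h : ℂ → ℂ}
    (hh : DifferentiableOn ℂ h U) {Z : Fin 2 → ℂ} (hZ : Z ∈ odeDomain U h) (i j k : Fin 2) :
    christoffel (odeMetric h) i j k Z = odeChristoffel h Z i j k := by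
  have hd : HasPartials (fun Y => h (Y 0)) (deriv h (Z 0)) 0 Z :=
    .comp_coord_zero (hh.differentiableAt (hU.mem_nhds hZ.1)).hasDerivAt
  have hX : Z 1 ≠ 0 := hZ.2.1
  have hs : h (Z 0) - Z 1 ^ 2 ≠ 0 := sub_ne_zero.2 hZ.2.2.symm
  have h11 := (HasPartials.const (Z := Z) 1).div HasPartials.coord_one.sq (pow_ne_zero 2 hX)
  have h00 := (hd.sub HasPartials.coord_one.sq).sq.div HasPartials.coord_one.sq (pow_ne_zero 2 hX)
  have h0 := HasPartials.const (Z := Z) 0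
  have hinv : (odeMetric h Z)⁻¹ = !![Z 1 ^ 2 / (h (Z 0) - Z 1 ^ 2) ^ 2, 0; 0, Z 1 ^ 2] := by
    refine Matrix.inv_eq_right_inv ?_
    ext a b
    fin_cases a <;> fin_cases b <;> simp [odeMetric, Matrix.mul_apply, hX, hs]
  simp only [christoffel, hinv, Fin.sum_univ_two]
  fin_cases i <;> fin_cases j <;> fin_cases k <;>
    simp [odeMetric, odeChristoffel, -one_div, h00.partialD_zero, h00.partialD_one,
      h11.partialD_zero, h11.partialD_one, h0.partialD_zero, h0.partialD_one] <;>
    field_simp <;> ring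

/-- All sixteen components are checked; the tensor has space-form shape, so every later curvature
claim is algebraic in the metric. -/
theorem riemann_odeMetric {U : Set ℂ} (hU : IsOpen U) {h : ℂ → ℂ}
    (hh : DifferentiableOn ℂ h U) {Z : Fin 2 → ℂ} (hZ : Z ∈ odeDomain U h) (i j k l : Fin 2) :
    riemann (odeMetric h) i j k l Z =
      -((if i = k then odeMetric h Z j l else 0) - if i = l then odeMetric h Z j k else 0) := by
  have hd : HasPartials (fun Y => h (Y 0)) (deriv h (Z 0)) 0 Z :=
    .comp_coord_zero (hh.differentiableAt (hU.mem_nhds hZ.1)).hasDerivAt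
  have hd' : HasPartials (fun Y => deriv h (Y 0)) (deriv (deriv h) (Z 0)) 0 Z :=
    .comp_coord_zero ((hh.deriv hU).differentiableAt (hU.mem_nhds hZ.1)).hasDerivAt
  have hX : Z 1 ≠ 0 := hZ.2.1
  have hs : h (Z 0) - Z 1 ^ 2 ≠ 0 := sub_ne_zero.2 hZ.2.2.symm
  have hX' := HasPartials.coord_one (Z := Z)
  have hs' := hd.sub hX'.sq
  have c0 := HasPartials.const (Z := Z) 0
  have c000 := hd'.div hs' hs
  have c001 := ((hd.add hX'.sq).div (hX'.mul hs') (mul_ne_zero hX hs)).neg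
  have c100 := (hs'.mul (hd.add hX'.sq)).div hX' hX
  have c111 := ((HasPartials.const (Z := Z) 1).div hX' hX).neg
  have hev : ∀ a b c : Fin 2, christoffel (odeMetric h) a b c =ᶠ[𝓝 Z]
      fun Y => odeChristoffel h Y a b c := fun a b c =>
    eventuallyEq_of_mem ((isOpen_odeDomain hU hh).mem_nhds hZ)
      fun Y hY => christoffel_odeMetric hU hh hY a b c
  simp only [riemann, partialD_congr (hev _ _ _), christoffel_odeMetric hU hh hZ, Fin.sum_univ_two]
  fin_cases i <;> fin_cases j <;> fin_cases k <;> fin_cases l <;>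
    simp [odeMetric, odeChristoffel, -one_div, c0.partialD_zero, c0.partialD_one,
      c000.partialD_zero, c000.partialD_one, c001.partialD_zero, c001.partialD_one,
      c100.partialD_zero, c100.partialD_one, c111.partialD_zero, c111.partialD_one] <;>
    field_simp <;> ring

/-- A surface whose curvature tensor is that of a space form of curvature `c` has constant
holomorphic sectional curvature `c`. -/
theorem hasConstantHolSectionalCurvature_of_riemann {D : Set (Fin 2 → ℂ)}
    {g : (Fin 2 → ℂ) → Matrix (Fin 2) (Fin 2) ℂ} {c : ℂ}
    (hsymm : ∀ Z ∈ D, (g Z).IsSymm)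
    (hR : ∀ Z ∈ D, ∀ i j k l, riemann g i j k l Z =
      c * ((if i = k then g Z j l else 0) - if i = l then g Z j k else 0)) :
    HasConstantHolSectionalCurvature D g c := by
  intro Z hZ u v huv
  rw [holSectionalCurvature, div_eq_iff huv]
  have h10 : g Z 1 0 = g Z 0 1 := (hsymm Z hZ).apply 0 1
  simp only [riemannLow, hR Z hZ, planeDisc, form, Fin.sum_univ_two, h10]
  simp
  ring

/-- The trace of the space-form tensor is c(n - 1)g, and here n = 2. -/
theorem ricci_of_riemann {g : (Fin 2 → ℂ) → Matrix (Fin 2) (Fin 2) ℂ} {Z : Fin 2 → ℂ} {c : ℂ}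
    (hR : ∀ i j k l, riemann g i j k l Z =
      c * ((if i = k then g Z j l else 0) - if i = l then g Z j k else 0)) :
    ricci g Z = c • g Z := by
  ext i j
  fin_cases i <;> fin_cases j <;> simp [ricci, hR]

end HolRiem

/-! ### Moving frame and developing map. -/

namespace HolRiem

open Metric Set

/-- The relation says that iq, t, n form an orthonormal basis. Take t orthogonal to q in the plane
of the first two coordinates, normalised by w, and n = -i t × q. -/
theorem exists_orthonormal_of_sum_sq_eq_neg_one_aux {q : Fin 3 → ℂ} (hq : ∑ i, q i ^ 2 = -1)
    (h0 : q 0 ^ 2 + q 1 ^ 2 ≠ 0) :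
    ∃ t n : Fin 3 → ℂ, ∀ a b, n a * n b + t a * t b - q a * q b = if a = b then 1 else 0 := by
  obtain ⟨w, hw⟩ := IsAlgClosed.exists_pow_nat_eq (q 0 ^ 2 + q 1 ^ 2) two_pos
  have hw0 : w ≠ 0 := by
    rintro rfl
    exact h0 (by simpa using hw.symm)
  have hc : q 2 ^ 2 = -1 - w ^ 2 := by
    rw [Fin.sum_univ_three] at hq
    linear_combination hq + hw
  have ha : q 0 ^ 2 = w ^ 2 - q 1 ^ 2 := by linear_combination -hw
  refine ⟨![q 1 / w, -(q 0 / w), 0],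
    ![Complex.I * (q 0 * q 2 / w), Complex.I * (q 1 * q 2 / w), -(Complex.I * w)], ?_⟩
  intro a b
  fin_cases a <;> fin_cases b <;> simp <;> field_simp <;> simp only [Complex.I_sq, hc] <;>
    ring_nf <;> (try simp only [ha]) <;> ring

theorem exists_orthonormal_of_sum_sq_eq_neg_one {q : Fin 3 → ℂ} (hq : ∑ i, q i ^ 2 = -1) :
    ∃ t n : Fin 3 → ℂ, ∀ a b, n a * n b + t a * t b - q a * q b = if a = b then 1 else 0 := by
  -- If all three pair sums vanished, adding them would give 2 · (-1) = 0.
  obtain ⟨σ, hσ⟩ : ∃ σ : Equiv.Perm (Fin 3), q (σ 0) ^ 2 + q (σ 1) ^ 2 ≠ 0 := by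
    by_contra! H
    have h1 := H 1
    have h2 := H (Equiv.swap 0 2)
    have h3 := H (Equiv.swap 1 2)
    rw [Fin.sum_univ_three] at hq
    simp [Equiv.swap_apply_def] at h1 h2 h3
    have h4 : (2 : ℂ) * (-1) = 0 := by linear_combination h1 + h2 + h3 - 2 * hq
    norm_num at h4
  obtain ⟨t, n, htn⟩ := exists_orthonormal_of_sum_sq_eq_neg_one_aux (q := q ∘ σ)
    (by rw [← hq]; exact Equiv.sum_comp σ fun i => q i ^ 2) hσ
  refine ⟨t ∘ σ.symm, n ∘ σ.symm, fun a b => ?_⟩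
  simpa using htn (σ.symm a) (σ.symm b)

/-- The Gram relations of a frame `(P, Q, N)` with `P`, `Q` isotropic and `N` a unit normal,
derived from the resolution of the identity. -/
theorem gram_of_resolution {P Q N : Fin 3 → ℂ}
    (H : ∀ a b, N a * N b - 2 * (P a * Q b + Q a * P b) = if a = b then 1 else 0) :
    P ⬝ᵥ P = 0 ∧ Q ⬝ᵥ Q = 0 ∧ P ⬝ᵥ Q = -1 / 2 ∧ N ⬝ᵥ N = 1 ∧ N ⬝ᵥ P = 0 ∧ N ⬝ᵥ Q = 0 := by
  -- The hypothesis is B Bᵀ = 1; the entries of Bᵀ B = 1 are the Gram relations.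
  let B : Matrix (Fin 3) (Fin 3) ℂ :=
    Matrix.of fun a => ![N a, P a - Q a, Complex.I * (P a + Q a)]
  have hB : B * B.transpose = 1 := by
    ext a b
    rw [Matrix.one_apply, ← H a b]
    simp [B, Matrix.mul_apply, Fin.sum_univ_three]
    linear_combination (P a + Q a) * (P b + Q b) * Complex.I_sq
  have hB' := mul_eq_one_comm.1 hB
  have h00 := congrFun₂ hB' 0 0
  have h01 := congrFun₂ hB' 0 1
  have h02 := congrFun₂ hB' 0 2
  have h11 := congrFun₂ hB' 1 1
  have h12 := congrFun₂ hB' 1 2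
  have h22 := congrFun₂ hB' 2 2
  simp [B, Matrix.mul_apply, Fin.sum_univ_three] at h00 h01 h02 h11 h12 h22
  have hI := Complex.I_sq
  simp only [dotProduct, Fin.sum_univ_three]
  have k02 : N 0 * (P 0 + Q 0) + N 1 * (P 1 + Q 1) + N 2 * (P 2 + Q 2) = 0 := by
    refine (mul_eq_zero.1 (?_ : Complex.I * _ = 0)).resolve_left Complex.I_ne_zero
    linear_combination h02
  have k12 : (P 0 - Q 0) * (P 0 + Q 0) + (P 1 - Q 1) * (P 1 + Q 1) +
      (P 2 - Q 2) * (P 2 + Q 2) = 0 := by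
    refine (mul_eq_zero.1 (?_ : Complex.I * _ = 0)).resolve_left Complex.I_ne_zero
    linear_combination h12
  have k22 : (P 0 + Q 0) ^ 2 + (P 1 + Q 1) ^ 2 + (P 2 + Q 2) ^ 2 = -1 := by
    linear_combination -h22 + ((P 0 + Q 0) ^ 2 + (P 1 + Q 1) ^ 2 + (P 2 + Q 2) ^ 2) * hI
  refine ⟨?_, ?_, ?_, h00, ?_, ?_⟩
  · linear_combination (h11 + k22 + 2 * k12) / 4
  · linear_combination (h11 + k22 - 2 * k12) / 4
  · linear_combination (k22 - h11) / 4
  · linear_combination (h01 + k02) / 2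
  · linear_combination (k02 - h01) / 2

/-- A moving frame `(P, Q, N)` of `ℂ³` solving the structure equations of `odeMetric h`. -/
theorem exists_moving_frame {U : Set ℂ} {z₀ : ℂ} (hU : U ∈ nhds z₀) {h : ℂ → ℂ}
    (hh : DifferentiableOn ℂ h U) {P₀ Q₀ N₀ : Fin 3 → ℂ}
    (H : ∀ a b, N₀ a * N₀ b - 2 * (P₀ a * Q₀ b + Q₀ a * P₀ b) = if a = b then 1 else 0) :
    ∃ r > 0, ball z₀ r ⊆ U ∧ ∃ P Q N : ℂ → Fin 3 → ℂ, P z₀ = P₀ ∧ Q z₀ = Q₀ ∧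
      (∀ z ∈ ball z₀ r, HasDerivAt P (-N z) z) ∧
      (∀ z ∈ ball z₀ r, HasDerivAt Q (h z • N z) z) ∧
      ∀ z ∈ ball z₀ r, ∀ a b,
        N z a * N z b - 2 * (P z a * Q z b + Q z a * P z b) = if a = b then 1 else 0 := by
  let E := (Fin 3 → ℂ) × (Fin 3 → ℂ) × (Fin 3 → ℂ)
  let p : E →L[ℂ] (Fin 3 → ℂ) := .fst ℂ _ _
  let q : E →L[ℂ] (Fin 3 → ℂ) := (ContinuousLinearMap.fst ℂ _ _).comp (.snd ℂ _ _)
  let n : E →L[ℂ] (Fin 3 → ℂ) := (ContinuousLinearMap.snd ℂ _ _).comp (.snd ℂ _ _)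
  -- The coefficient is affine in h(z), hence holomorphic.
  let A : ℂ → E →L[ℂ] E := fun z =>
    (-n).prod ((0 : E →L[ℂ] (Fin 3 → ℂ)).prod (-((2 : ℂ) • q))) +
      h z • (0 : E →L[ℂ] (Fin 3 → ℂ)).prod (n.prod ((2 : ℂ) • p))
  have hA : DifferentiableOn ℂ A U := (hh.smul_const _).const_add _
  obtain ⟨r, hr, hrU, y, hy₀, hy⟩ := exists_hasDerivAt_linear hU hA (P₀, Q₀, N₀)
  have hP : ∀ z ∈ ball z₀ r, HasDerivAt (fun z => (y z).1) (-(y z).2.2) z := fun z hz =>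
    (p.hasFDerivAt.comp_hasDerivAt z (hy z hz)).congr_deriv (by
      change -(y z).2.2 + h z • (0 : Fin 3 → ℂ) = _
      rw [smul_zero, add_zero])
  have hQ : ∀ z ∈ ball z₀ r, HasDerivAt (fun z => (y z).2.1) (h z • (y z).2.2) z :=
    fun z hz =>
    (q.hasFDerivAt.comp_hasDerivAt z (hy z hz)).congr_deriv (by
      change 0 + h z • (y z).2.2 = _
      rw [zero_add])
  have hN : ∀ z ∈ ball z₀ r, HasDerivAt (fun z => (y z).2.2)
      (-((2 : ℂ) • (y z).2.1) + h z • (2 : ℂ) • (y z).1) z := fun z hz =>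
    (n.hasFDerivAt.comp_hasDerivAt z (hy z hz)).congr_deriv rfl
  refine ⟨r, hr, hrU, fun z => (y z).1, fun z => (y z).2.1, fun z => (y z).2.2,
    by simp [hy₀], by simp [hy₀], hP, hQ, fun z hz a b => ?_⟩
  -- The resolution of the identity is a first integral of the system.
  have hd : ∀ x ∈ ball z₀ r, HasDerivAt (fun z => (y z).2.2 a * (y z).2.2 b -
      2 * ((y z).1 a * (y z).2.1 b + (y z).2.1 a * (y z).1 b)) 0 x := by
    intro x hx
    have hP' := hasDerivAt_pi.1 (hP x hx)
    have hQ' := hasDerivAt_pi.1 (hQ x hx)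
    have hN' := hasDerivAt_pi.1 (hN x hx)
    refine (((hN' a).mul (hN' b)).sub ((((hP' a).mul (hQ' b)).add
      ((hQ' a).mul (hP' b))).const_mul 2)).congr_deriv ?_
    simp
    ring
  rw [← H a b]
  have hconst := isOpen_ball.is_const_of_deriv_eq_zero (convex_ball z₀ r).isPreconnected
    (fun x hx => (hd x hx).differentiableAt.differentiableWithinAt) (fun x hx => (hd x hx).deriv)
    hz (mem_ball_self hr)
  simpa [hy₀] using hconst

/-- The developing map of `odeMetric h` into the complex sphere. -/
theorem exists_developing_map {U : Set ℂ} (hU : IsOpen U) {h : ℂ → ℂ}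
    (hh : DifferentiableOn ℂ h U) {p : Fin 2 → ℂ} (hp : p ∈ odeDomain U h) {q : Fin 3 → ℂ}
    (hq : q ∈ complexSphere 2 Complex.I) :
    ∃ (D : Set (Fin 2 → ℂ)) (F : (Fin 2 → ℂ) → (Fin 3 → ℂ)), IsOpen D ∧ p ∈ D ∧
      D ⊆ odeDomain U h ∧ F p = q ∧ ContDiffOn ℂ 1 F D ∧ MapsTo F D (complexSphere 2 Complex.I) ∧
      ∀ Z ∈ D, ∀ u v : Fin 2 → ℂ,
        ∑ a, fderiv ℂ F Z u a * fderiv ℂ F Z v a = form (odeMetric h) Z u v := by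
  have hq' : ∑ i, q i ^ 2 = -1 := by rw [← Complex.I_sq]; exact hq
  obtain ⟨t, n, htn⟩ := exists_orthonormal_of_sum_sq_eq_neg_one hq'
  have hx0 : p 1 ≠ 0 := hp.2.1
  -- With X = `p 1`, these initial values give X P₀ + Q₀/X = q and 2(P₀Q₀ᵀ + Q₀P₀ᵀ) = qqᵀ - ttᵀ.
  obtain ⟨r, hr, hrU, P, Q, N, hP₀, hQ₀, hP, hQ, hrel⟩ :=
    exists_moving_frame (hU.mem_nhds hp.1) hh (P₀ := fun a => (q a + t a) / (2 * p 1))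
      (Q₀ := fun a => p 1 * (q a - t a) / 2) (N₀ := n) (fun a b => by
        rw [← htn a b]; field_simp; ring)
  let D : Set (Fin 2 → ℂ) := odeDomain U h ∩ {Z | Z 0 ∈ ball (p 0) r}
  let F : (Fin 2 → ℂ) → (Fin 3 → ℂ) := fun Z => Z 1 • P (Z 0) + (Z 1)⁻¹ • Q (Z 0)
  have hPc : ContDiffOn ℂ 1 P (ball (p 0) r) := DifferentiableOn.contDiffOn
    (fun z hz => (hP z hz).differentiableAt.differentiableWithinAt) isOpen_ball
  have hQc : ContDiffOn ℂ 1 Q (ball (p 0) r) := DifferentiableOn.contDiffOn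
    (fun z hz => (hQ z hz).differentiableAt.differentiableWithinAt) isOpen_ball
  have h0 : ContDiffOn ℂ 1 (fun Z : Fin 2 → ℂ => Z 0) D := (contDiff_apply ℂ ℂ 0).contDiffOn
  have h1 : ContDiffOn ℂ 1 (fun Z : Fin 2 → ℂ => Z 1) D := (contDiff_apply ℂ ℂ 1).contDiffOn
  refine ⟨D, F, (isOpen_odeDomain hU hh).inter (isOpen_ball.preimage (continuous_apply 0)),
    ⟨hp, mem_ball_self hr⟩, inter_subset_left, ?_, ?_, ?_, ?_⟩
  · ext a
    simp [F, hP₀, hQ₀]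
    field_simp
    ring
  · exact (h1.smul (hPc.comp h0 fun Z hZ => hZ.2)).add
      ((h1.inv fun Z hZ => hZ.1.2.1).smul (hQc.comp h0 fun Z hZ => hZ.2))
  · intro Z hZ
    obtain ⟨hPP, hQQ, hPQ, -, -, -⟩ := gram_of_resolution (hrel _ hZ.2)
    have hX : Z 1 * (Z 1)⁻¹ = 1 := mul_inv_cancel₀ hZ.1.2.1
    simp only [dotProduct, Fin.sum_univ_three] at hPP hQQ hPQ
    change ∑ a : Fin 3, F Z a ^ 2 = Complex.I ^ 2
    simp only [Fin.sum_univ_three, F, Pi.add_apply, Pi.smul_apply,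
      smul_eq_mul, Complex.I_sq]
    linear_combination Z 1 ^ 2 * hPP + (Z 1)⁻¹ ^ 2 * hQQ + 2 * (Z 1 * (Z 1)⁻¹) * hPQ - hX
  · intro Z hZ u v
    obtain ⟨hPP, hQQ, hPQ, hNN, hNP, hNQ⟩ := gram_of_resolution (hrel _ hZ.2)
    have hX : Z 1 ≠ 0 := hZ.1.2.1
    have hF : ∀ w a, fderiv ℂ F Z w a = w 0 * ((h (Z 0) / Z 1 - Z 1) * N (Z 0) a) +
        w 1 * (P (Z 0) a - Q (Z 0) a / Z 1 ^ 2) := by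
      intro w a
      have hFa : HasPartials (fun Y => F Y a) ((h (Z 0) / Z 1 - Z 1) * N (Z 0) a)
          (P (Z 0) a - Q (Z 0) a / Z 1 ^ 2) Z := by
        have hPa := HasPartials.comp_coord_zero (hasDerivAt_pi.1 (hP _ hZ.2) a)
        have hQa := HasPartials.comp_coord_zero (hasDerivAt_pi.1 (hQ _ hZ.2) a)
        have hFa := (HasPartials.coord_one.mul hPa).add (hQa.div HasPartials.coord_one hX)
        refine (hFa.congr ?_ ?_).congr_of_eventuallyEq (.of_forall fun Y => ?_)
        · simp
          field_simp
          ring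
        · simp
          field_simp
          ring
        · simp [F, div_eq_inv_mul]
      have hFd : DifferentiableAt ℂ F Z := differentiableAt_pi.2 fun b => by
        have hPb := HasPartials.comp_coord_zero (hasDerivAt_pi.1 (hP _ hZ.2) b)
        have hQb := HasPartials.comp_coord_zero (hasDerivAt_pi.1 (hQ _ hZ.2) b)
        have hFb := (HasPartials.coord_one.mul hPb).add (hQb.div HasPartials.coord_one hX)
        exact HasFDerivAt.differentiableAt (hFb.congr_of_eventuallyEq (g := fun Y => F Y b)
          (.of_forall fun Y => by simp [F, div_eq_inv_mul]))
      have h2 := (hasFDerivAt_pi'.1 hFd.hasFDerivAt a).unique hFa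
      have h3 := DFunLike.congr_fun h2 w
      simp at h3
      rw [h3]
      ring
    simp only [dotProduct, Fin.sum_univ_three] at hPP hQQ hPQ hNN hNP hNQ
    have hg0 : (h (Z 0) - Z 1 ^ 2) ^ 2 / Z 1 ^ 2 = (h (Z 0) / Z 1 - Z 1) ^ 2 := by
      field_simp
    simp only [hF, form, Fin.sum_univ_three, Fin.sum_univ_two]
    simp [odeMetric, hg0]
    generalize h (Z 0) / Z 1 - Z 1 = A
    simp only [div_eq_mul_inv]
    generalize (Z 1 ^ 2)⁻¹ = B
    linear_combination u 0 * v 0 * A ^ 2 * hNN + u 1 * v 1 * hPP + u 1 * v 1 * B ^ 2 * hQQ -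
      2 * u 1 * v 1 * B * hPQ + (u 0 * v 1 + u 1 * v 0) * A * hNP -
      (u 0 * v 1 + u 1 * v 0) * A * B * hNQ

end HolRiem

theorem mainTheorem4 (U : Set ℂ) (hU : IsOpen U) (h : ℂ → ℂ) (hh : DifferentiableOn ℂ h U) :
    HolRiem.IsHolomorphicMetric (HolRiem.odeDomain U h) (HolRiem.odeMetric h) ∧
    HolRiem.HasConstantHolSectionalCurvature (HolRiem.odeDomain U h) (HolRiem.odeMetric h) (-1) ∧
    (∀ Z ∈ HolRiem.odeDomain U h, HolRiem.ricci (HolRiem.odeMetric h) Z = -HolRiem.odeMetric h Z) ∧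
    (∀ p ∈ HolRiem.odeDomain U h, ∀ q ∈ HolRiem.complexSphere 2 Complex.I,
      ∃ (W : Set (Fin 2 → ℂ)) (O : Set (Fin 3 → ℂ)) (F : (Fin 2 → ℂ) → (Fin 3 → ℂ)),
        p ∈ W ∧ W ⊆ HolRiem.odeDomain U h ∧ F p = q ∧
        HolRiem.IsHolomorphicIsometryOnto (HolRiem.odeMetric h) W
          (HolRiem.complexSphere 2 Complex.I) O F) := by
  have hmetric := HolRiem.isHolomorphicMetric_odeMetric hU hh
  refine ⟨hmetric, HolRiem.hasConstantHolSectionalCurvature_of_riemann hmetric.symm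
    fun Z hZ i j k l => ?_, fun Z hZ => ?_, fun p hp q hq => ?_⟩
  · rw [HolRiem.riemann_odeMetric hU hh hZ, neg_one_mul]
  · rw [HolRiem.ricci_of_riemann (c := -1) fun i j k l => by
      rw [HolRiem.riemann_odeMetric hU hh hZ, neg_one_mul], neg_one_smul]
  · obtain ⟨D, F, hD, hpD, hDsub, hFp, hF, hmaps, hiso⟩ :=
      HolRiem.exists_developing_map hU hh hp hq
    obtain ⟨W, O, hpW, hWD, hWO⟩ := HolRiem.exists_isHolomorphicIsometryOnto hD hpD
      Complex.I_ne_zero (hmetric.nondegenerate p hp) hF hmaps hiso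
    exact ⟨W, O, F, hpW, hWD.trans hDsub, hFp, hWO⟩
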